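/- Let $T$ be a finite tree with vertex set $V$, and let $d_T(u,v)$ be the number of edges of the path from $u$ to $v$; for nonempty $U,W\subseteq V$ put $d_T(U,W)=\min\{d_T(u,w):u\in U,\ w\in W\}$. A subtree of $T$ is a subgraph of $T$ that is a (nonempty) tree. - The center $C=C(T)$ is the set of vertices $v$ whose eccentricity $\max_{u\in V}d_T(u,v)$ is minimum. - A branch at $v$ is a maximal subtree of $T$ containing $v$ as a vertex of degree $1$; the weight of $v$ is the maximum number of edges in a branch at $v$. The centroid $C_d=C_d(T)$ is the set of vertices of minimum weight. - The subtree core $S_c=S_c(T)$ is the set of vertices $v$ for which the number of subtrees of $T$ containing $v$ is maximum. For $n\ge 5$ and $2\le g\le n-3$, the path-star tree $P_{n-g,g}$ is the tree on $n$ vertices obtained from the path with vertices $1,2,\dots,n-g$ (in this order) by attaching $g$ pendant vertices to the end vertex $n-g$. **Theorem.** Let $n\ge 5$ and let $g_0$ be the least positive integer with $2^{g_0}+g_0>n-1$. Then for every tree $T$ on $n$ vertices, (i) $d_T(C,S_c)\le\left\lfloor\frac{n-g_0}{2}\right\rfloor-1$, and (ii) $d_T(C_d,S_c)\le\left\lfloor\frac{n-1}{2}\right\rfloor-g_0$.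 Further, $2\le g_0\le n-3$, and the path-star tree $P_{n-g_0,g_0}$ attains equality in both (i) and (ii). -/

import Mathlib

namespace PathStar

/-- The distance `d_T(U, W) = min {d_T(u, w) : u ∈ U, w ∈ W}` between two (nonempty) sets of
vertices of a connected graph. -/
noncomputable def setDist {V : Type*} (T : SimpleGraph V) (U W : Set V) : ℕ :=
  sInf {d : ℕ | ∃ u ∈ U, ∃ w ∈ W, T.dist u w = d}

/-- A subtree of `T`: a subgraph which is a tree (in particular nonempty). -/
def IsSubtree {V : Type*} {T : SimpleGraph V} (H : T.Subgraph) : Prop :=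
  H.coe.IsTree

/-- A branch of `T` at `v`: a maximal subtree containing `v` as a pendant vertex, i.e. as a vertex
with exactly one neighbour in the subtree. -/
def IsBranch {V : Type*} {T : SimpleGraph V} (v : V) (H : T.Subgraph) : Prop :=
  Maximal (fun K : T.Subgraph => IsSubtree K ∧ v ∈ K.verts ∧ ∃! w, K.Adj v w) H

/-- The weight of `v`: the maximal number of edges in any branch at `v`
(for a finite graph, the supremum is over a finite set). -/
noncomputable def weight {V : Type*} (T : SimpleGraph V) (v : V) : ℕ :=
  sSup {k : ℕ | ∃ H : T.Subgraph, IsBranch v H ∧ H.edgeSet.ncard = k}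

/-- The centroid `C_d(T)`: the set of vertices of minimal weight. -/
def centroid {V : Type*} (T : SimpleGraph V) : Set V :=
  {v | ∀ u, weight T v ≤ weight T u}

/-- `f_T(v)`: the number of subtrees of `T` containing `v`. -/
noncomputable def subtreeCount {V : Type*} (T : SimpleGraph V) (v : V) : ℕ :=
  {H : T.Subgraph | IsSubtree H ∧ v ∈ H.verts}.ncard

/-- The subtree core `S_c(T)`: the set of vertices contained in the maximal number of subtrees. -/
def subtreeCore {V : Type*} (T : SimpleGraph V) : Set V :=
  {v | ∀ u, subtreeCount T u ≤ subtreeCount T v}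

/-- The graph `P_{n-g,g}` on `n` vertices (for `g < n`): the path on the `n - g` vertices
`0, 1, …, n - g - 1` of `Fin n`, with the remaining `g` vertices `n - g, …, n - 1` attached as
pendant vertices to the end vertex `n - g - 1` of the path. -/
def pathStar (n g : ℕ) : SimpleGraph (Fin n) :=
  SimpleGraph.fromRel fun i j =>
    (i.val + 1 = j.val ∧ j.val < n - g) ∨ (i.val + 1 = n - g ∧ n - g ≤ j.val)

end PathStar

/-!
For an edge `uv` of a tree, let `side T u v` be the component of `u` in `T - uv`. Subtrees containing
both `u` and `v` count equally for both, so `v` lies in more subtrees than `u` exactly when more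
subtrees contain `v` and avoid `u` than the other way round (`subtreeCount_lt_iff`). A subtree
containing `v` and avoiding `u` stays in the component of `v`; with `k` vertices there, at most
`2 ^ (k - 1)` of them exist (`avoidCount_le_two_pow`), while the paths starting at `u` give at least
`n - k` on the other side (`ncard_side_le_avoidCount`). Hence an edge entering the subtree core leads
into a component with `n < 2 ^ (k - 1) + k`, that is, with `k ≥ g₀ + 1`
(`card_lt_of_subtreeCount_lt`).

Take now a shortest path `u, x, …, x', s` of length `d ≥ 1` from the centre or the centroid to the
subtree core. The component of `s` beyond `x's` has at least `g₀ + 1` vertices, so the component of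
`x` beyond `ux` has at least `g₀ + d` (`exists_geodesic_of_setDist_pos`).

* If `u` is in the centroid and `x` is not, the component of `x` is the smaller one at `ux`, so it
  has at most `⌊(n - 1) / 2⌋` vertices (`ncard_side_lt_of_notMem_centroid`).
* If `u` is central and `x` is not, the component of `u` is deeper than that of `x`. The latter
  contains a vertex at distance at least `d + 1` from `u`, so the component of `u` has at least `d + 2`
  vertices, and `(d + 2) + (g₀ + d) ≤ n` (`setDist_center_subtreeCore_le`).

In the path-star with `g₀` leaves both counts are sharp: along the path, subtrees on the far side
are intervals ending in a given vertex (`avoidCount_pathStar_le`), and those towards the star include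
all choices of leaves (`two_pow_le_avoidCount_pathStar`). So the subtree core is the centre of the
star, and comparing neighbours on the path confines the centre and the centroid to the required
distance from it.
-/

namespace PathStar

/-! ### Distances in trees -/

/-- The vertices strictly closer to `u` than to `v`. If `uv` is an edge of a tree `T`, this is the
vertex set of the component of `u` in `T - uv`. -/
def side {V : Type*} (T : SimpleGraph V) (u v : V) : Set V :=
  {y | T.dist u y < T.dist v y}

variable {V : Type*} {T : SimpleGraph V}

lemma mem_side {u v y : V} : y ∈ side T u v ↔ T.dist u y < T.dist v y := Iff.rfl

/-- A shortest path is the only path between its ends, so every walk runs through all its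
vertices. -/
lemma mem_support_of_dist_add (hT : T.IsTree) {x y z : V}
    (h : T.dist x z + T.dist z y = T.dist x y) (p : T.Walk x y) : z ∈ p.support := by
  classical
  obtain ⟨q₁, h₁⟩ := hT.1.exists_walk_length_eq_dist x z
  obtain ⟨q₂, h₂⟩ := hT.1.exists_walk_length_eq_dist z y
  have hq : (q₁.append q₂).IsPath := by
    apply SimpleGraph.Walk.isPath_of_length_eq_dist
    rw [SimpleGraph.Walk.length_append, h₁, h₂, h]
  have heq : q₁.append q₂ = p.bypass :=
    congrArg Subtype.val ((hT.isAcyclic.subsingleton_path _ _).elim ⟨_, hq⟩ ⟨_, p.bypass_isPath⟩)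
  apply p.support_bypass_subset_support
  rw [← heq, SimpleGraph.Walk.mem_support_append_iff]
  exact Or.inl q₁.end_mem_support

/-- The vertices `z 0, z 1, …` of a shortest path from `x` to `y`. -/
lemma exists_geodesic (hT : T.Connected) (x y : V) :
    ∃ z : ℕ → V, z 0 = x ∧ z (T.dist x y) = y ∧
      ∀ i j, i ≤ j → j ≤ T.dist x y → T.dist (z i) (z j) = j - i := by
  obtain ⟨p, hp⟩ := hT.exists_walk_length_eq_dist x y
  have hle : ∀ i j, i ≤ j → T.dist (p.getVert i) (p.getVert j) ≤ j - i := by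
    intro i j hij
    induction j, hij using Nat.le_induction with
    | base => simp
    | succ j hij ih =>
      have h1 := hT.dist_triangle (u := p.getVert i) (v := p.getVert j) (w := p.getVert (j + 1))
      have h2 : T.dist (p.getVert j) (p.getVert (j + 1)) ≤ 1 := by
        rcases lt_or_ge j p.length with hj | hj
        · exact (SimpleGraph.dist_eq_one_iff_adj.2 (p.adj_getVert_succ hj)).le
        · rw [p.getVert_of_length_le hj, p.getVert_of_length_le (by omega)]
          simp
      omega
  have h0 : p.getVert 0 = x := p.getVert_zero
  have h1 : p.getVert (T.dist x y) = y := by rw [← hp, p.getVert_length]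
  refine ⟨p.getVert, h0, h1, fun i j hij hj ↦ ?_⟩
  have a := hle 0 i (Nat.zero_le _)
  have b := hle i j hij
  have c := hle j (T.dist x y) hj
  rw [h0] at a
  rw [h1] at c
  have d := hT.dist_triangle (u := x) (v := p.getVert i) (w := y)
  have e := hT.dist_triangle (u := p.getVert i) (v := p.getVert j) (w := y)
  omega

lemma exists_adj_dist_add_one (hT : T.Connected) {x y : V} (hxy : x ≠ y) :
    ∃ w, T.Adj x w ∧ T.dist w y + 1 = T.dist x y := by
  obtain ⟨z, h0, h1, hz⟩ := exists_geodesic hT x y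
  have hpos := hT.pos_dist_of_ne hxy
  have a := hz 0 1 (by omega) hpos
  have b := hz 1 _ hpos le_rfl
  rw [h0] at a
  rw [h1] at b
  exact ⟨z 1, SimpleGraph.dist_eq_one_iff_adj.1 a, by omega⟩

/-- Across an edge of a tree, the distances to a fixed vertex differ by exactly one. -/
lemma dist_adj_cases (hT : T.IsTree) {u v : V} (h : T.Adj u v) (y : V) :
    T.dist u y = T.dist v y + 1 ∨ T.dist v y = T.dist u y + 1 := by
  rw [T.dist_comm (u := u), T.dist_comm (u := v)]
  exact hT.dist_eq_dist_add_one_of_adj y h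

/-- Paths between the two components of `T - xs` use the edge `xs`. -/
lemma dist_across (hT : T.IsTree) {x s a y : V} (hxs : T.Adj x s) (ha : a ∈ side T x s)
    (hy : y ∈ side T s x) : T.dist a y = T.dist a x + 1 + T.dist s y := by
  classical
  rw [mem_side] at ha hy
  have ha' := dist_adj_cases hT hxs a
  have hy' := dist_adj_cases hT hxs y
  obtain ⟨p, hp⟩ := hT.1.exists_walk_length_eq_dist a y
  obtain ⟨q, hq⟩ := hT.1.exists_walk_length_eq_dist y s
  have hx : x ∈ (p.append q).support := by
    apply mem_support_of_dist_add hT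
    rw [SimpleGraph.dist_eq_one_iff_adj.2 hxs, T.dist_comm (u := a), T.dist_comm (u := a)]
    omega
  rw [SimpleGraph.Walk.mem_support_append_iff] at hx
  rcases hx with hx | hx
  · have h1 := SimpleGraph.dist_le (p.takeUntil x hx)
    have h2 := SimpleGraph.dist_le (p.dropUntil x hx)
    have h3 := congrArg SimpleGraph.Walk.length (p.take_spec hx)
    rw [SimpleGraph.Walk.length_append] at h3
    have h4 := hT.1.dist_triangle (u := a) (v := x) (w := y)
    omega
  · have h1 := SimpleGraph.dist_le (q.takeUntil x hx)
    have h2 := SimpleGraph.dist_le (q.dropUntil x hx)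
    have h3 := congrArg SimpleGraph.Walk.length (q.take_spec hx)
    rw [SimpleGraph.Walk.length_append] at h3
    rw [T.dist_comm (u := y)] at h1 hq
    omega

lemma side_disjoint (u v : V) : Disjoint (side T u v) (side T v u) := by
  rw [Set.disjoint_left]
  intro y h1 h2
  rw [mem_side] at h1 h2
  omega

lemma ncard_side_add [Fintype V] (hT : T.IsTree) {u v : V} (h : T.Adj u v) :
    (side T u v).ncard + (side T v u).ncard = Fintype.card V := by
  rw [← Set.ncard_union_eq (side_disjoint u v), ← Nat.card_eq_fintype_card, ← Set.ncard_univ]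
  congr 1
  rw [Set.eq_univ_iff_forall]
  intro y
  have := dist_adj_cases hT h y
  rw [Set.mem_union, mem_side, mem_side]
  omega

lemma mem_side_self {u v : V} (h : T.Adj u v) : u ∈ side T u v := by
  rw [mem_side, SimpleGraph.dist_self, SimpleGraph.dist_eq_one_iff_adj.2 h.symm]
  exact one_pos

/-! ### Subtrees of a tree -/

/-- Subtrees are convex. -/
lemma IsSubtree.mem_of_dist_add (hT : T.IsTree) {H : T.Subgraph} (hH : IsSubtree H) {x y z : V}
    (hx : x ∈ H.verts) (hy : y ∈ H.verts) (h : T.dist x z + T.dist z y = T.dist x y) :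
    z ∈ H.verts := by
  have hc : H.Connected := ⟨hH.1⟩
  obtain ⟨p, hp⟩ := (H.connected_iff_forall_exists_walk_subgraph.1 hc).2 hx hy
  exact hp.1 ((p.mem_verts_toSubgraph).2 (mem_support_of_dist_add hT h p))

lemma IsSubtree.adj (hT : T.IsTree) {H : T.Subgraph} (hH : IsSubtree H) {x y : V}
    (hx : x ∈ H.verts) (hy : y ∈ H.verts) (h : T.Adj x y) : H.Adj x y := by
  classical
  have hc : H.Connected := ⟨hH.1⟩
  obtain ⟨p, hp⟩ := (H.connected_iff_forall_exists_walk_subgraph.1 hc).2 hx hy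
  have heq : h.toWalk = p.bypass := congrArg Subtype.val ((hT.isAcyclic.subsingleton_path _ _).elim
    ⟨h.toWalk, SimpleGraph.Walk.isPath_of_length_eq_dist _
      (by simp [SimpleGraph.dist_eq_one_iff_adj.2 h])⟩ ⟨_, p.bypass_isPath⟩)
  have hle : h.toWalk.toSubgraph ≤ H := by
    rw [heq]
    exact (SimpleGraph.Walk.toSubgraph_bypass_le_toSubgraph).trans hp
  refine hle.2 ?_
  simp

/-- A subtree of a tree is an induced subgraph, so it is determined by its vertices. -/
lemma IsSubtree.le_of_verts (hT : T.IsTree) {H K : T.Subgraph} (hK : IsSubtree K)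
    (h : H.verts ⊆ K.verts) : H ≤ K :=
  ⟨h, fun _ _ hxy ↦ hK.adj hT (h hxy.fst_mem) (h hxy.snd_mem) hxy.adj_sub⟩

lemma IsSubtree.ext (hT : T.IsTree) {H K : T.Subgraph} (hH : IsSubtree H) (hK : IsSubtree K)
    (h : H.verts = K.verts) : H = K :=
  le_antisymm (hK.le_of_verts hT h.subset) (hH.le_of_verts hT h.superset)

/-- A vertex set spans a subtree as soon as each of its vertices other than `r` has a neighbour in
the set at which `μ` is smaller. -/
lemma isSubtree_induce (hT : T.IsAcyclic) {K : Set V} {r : V} (hr : r ∈ K) (μ : V → ℕ)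
    (h : ∀ z ∈ K, z ≠ r → ∃ w ∈ K, T.Adj w z ∧ μ w < μ z) :
    IsSubtree ((⊤ : T.Subgraph).induce K) := by
  have hreach : ∀ m : ℕ, ∀ z (hz : z ∈ K), μ z = m →
      ((⊤ : T.Subgraph).induce K).coe.Reachable ⟨r, hr⟩ ⟨z, hz⟩ := by
    intro m
    induction m using Nat.strong_induction_on with
    | _ m ih =>
      intro z hz hm
      by_cases hzr : z = r
      · subst hzr
        exact SimpleGraph.Reachable.refl _
      · obtain ⟨w, hw, hwz, hlt⟩ := h z hz hzr
        refine (ih (μ w) (hm ▸ hlt) w hw rfl).trans (SimpleGraph.Adj.reachable ?_)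
        simp [hw, hz, hwz]
  refine ⟨?_, hT.subgraph _⟩
  have : Nonempty ((⊤ : T.Subgraph).induce K).verts := ⟨⟨r, hr⟩⟩
  exact ⟨fun a b ↦ (hreach _ a.1 a.2 rfl).symm.trans (hreach _ b.1 b.2 rfl)⟩

/-! ### Subtrees that contain one vertex and avoid another -/

/-- The number of subtrees that contain `u` but not `v`. -/
noncomputable def avoidCount {V : Type*} (T : SimpleGraph V) (u v : V) : ℕ :=
  {H : T.Subgraph | IsSubtree H ∧ u ∈ H.verts ∧ v ∉ H.verts}.ncard

/-- Subtrees containing both `u` and `v` contribute equally to the subtree counts of both. -/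
lemma subtreeCount_lt_iff [Finite V] (u v : V) :
    subtreeCount T v < subtreeCount T u ↔ avoidCount T v u < avoidCount T u v := by
  have key : ∀ u v : V, subtreeCount T u = avoidCount T u v +
      {H : T.Subgraph | IsSubtree H ∧ u ∈ H.verts ∧ v ∈ H.verts}.ncard := by
    intro u v
    rw [subtreeCount, avoidCount, ← Set.ncard_union_eq]
    · congr 1
      ext H
      simp only [Set.mem_ofPred_eq, Set.mem_union]
      tauto
    · rw [Set.disjoint_left]
      rintro H ⟨-, -, h⟩ ⟨-, -, h'⟩
      exact h h'
  rw [key u v, key v u]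
  have : {H : T.Subgraph | IsSubtree H ∧ u ∈ H.verts ∧ v ∈ H.verts} =
      {H : T.Subgraph | IsSubtree H ∧ v ∈ H.verts ∧ u ∈ H.verts} := by
    ext H
    simp only [Set.mem_ofPred_eq]
    tauto
  rw [this]
  omega

lemma IsSubtree.verts_subset_side (hT : T.IsTree) {H : T.Subgraph} (hH : IsSubtree H) {u v : V}
    (huv : T.Adj u v) (hu : u ∈ H.verts) (hv : v ∉ H.verts) : H.verts ⊆ side T u v := by
  intro y hy
  rw [mem_side]
  by_contra hlt
  apply hv
  apply hH.mem_of_dist_add hT hu hy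
  rw [SimpleGraph.dist_eq_one_iff_adj.2 huv]
  have := dist_adj_cases hT huv y
  omega

lemma avoidCount_le_two_pow [Finite V] (hT : T.IsTree) {u v : V} (huv : T.Adj u v) :
    avoidCount T u v ≤ 2 ^ ((side T u v).ncard - 1) := by
  rw [← Set.ncard_sdiff_singleton_of_mem (mem_side_self huv), ← Set.ncard_powerset]
  apply Set.ncard_le_ncard_of_injOn (fun H : T.Subgraph ↦ H.verts \ {u})
  · rintro H ⟨hH, hu, hv⟩
    exact Set.sdiff_subset_sdiff_left (hH.verts_subset_side hT huv hu hv)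
  · rintro H ⟨hH, hu, -⟩ K ⟨hK, hu', -⟩ heq
    apply hH.ext hT hK
    rw [← Set.insert_eq_of_mem hu, ← Set.insert_eq_of_mem hu', ← Set.insert_sdiff_singleton,
      ← Set.insert_sdiff_singleton (s := K.verts)]
    exact congrArg (insert u) heq

/-- The paths from `u` to the vertices closer to `u` than to `v` are pairwise different subtrees
avoiding `v`. -/
lemma ncard_side_le_avoidCount [Finite V] (hT : T.IsTree) {u v : V} (huv : T.Adj u v) :
    (side T u v).ncard ≤ avoidCount T u v := by
  let I : V → Set V := fun y ↦ {z | T.dist u z + T.dist z y = T.dist u y}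
  apply Set.ncard_le_ncard_of_injOn (fun y ↦ (⊤ : T.Subgraph).induce (I y))
  · intro y hy
    rw [mem_side] at hy
    have hu : u ∈ I y := by simp [I]
    refine ⟨isSubtree_induce hT.isAcyclic hu (T.dist u) ?_, hu, ?_⟩
    · intro z hz hzu
      obtain ⟨w, hw, hd⟩ := exists_adj_dist_add_one hT.1 hzu
      have h1 := hT.1.dist_triangle (u := w) (v := z) (w := y)
      have h2 := hT.1.dist_triangle (u := u) (v := w) (w := y)
      rw [SimpleGraph.dist_eq_one_iff_adj.2 hw.symm] at h1
      rw [T.dist_comm (u := w), T.dist_comm (u := z)] at hd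
      simp only [I, Set.mem_ofPred_eq] at hz ⊢
      exact ⟨w, by omega, hw.symm, by omega⟩
    · intro hv
      simp only [SimpleGraph.Subgraph.induce_verts, I, Set.mem_ofPred_eq] at hv
      have := hT.1.pos_dist_of_ne huv.ne
      omega
  · intro y _ y' _ heq
    have h : I y = I y' := congrArg SimpleGraph.Subgraph.verts heq
    have h1 : y ∈ I y' := by rw [← h]; simp [I]
    have h2 : y' ∈ I y := by rw [h]; simp [I]
    simp only [I, Set.mem_ofPred_eq] at h1 h2
    exact hT.1.dist_eq_zero_iff.1 (by omega)

/-- The larger of two adjacent subtree counts forces a large component: with `k` vertices on the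
side of `s` there are at most `2 ^ (k - 1)` subtrees through `s` avoiding `x`, and at least
`n - k` subtrees through `x` avoiding `s`. -/
lemma card_lt_of_subtreeCount_lt [Fintype V] (hT : T.IsTree) {x s : V} (hxs : T.Adj x s)
    (h : subtreeCount T x < subtreeCount T s) :
    Fintype.card V < 2 ^ ((side T s x).ncard - 1) + (side T s x).ncard := by
  have h1 := (subtreeCount_lt_iff s x).1 h
  have h2 := avoidCount_le_two_pow hT hxs.symm
  have h3 := ncard_side_le_avoidCount hT hxs
  have h4 := ncard_side_add hT hxs
  omega

/-! ### Weights of vertices -/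

lemma IsSubtree.ncard_edgeSet_add_one [Finite V] {H : T.Subgraph} (hH : IsSubtree H) :
    H.edgeSet.ncard + 1 = H.verts.ncard := by
  classical
  have := Fintype.ofFinite H.verts
  have := Fintype.ofFinite H.coe.edgeSet
  rw [← H.image_coe_edgeSet_coe,
    Set.ncard_image_of_injective _ (Sym2.map.injective Subtype.val_injective),
    ← SimpleGraph.coe_edgeFinset, Set.ncard_coe_finset, hH.card_edgeFinset,
    ← Nat.card_eq_fintype_card, Nat.card_coe_set_eq]

lemma IsSubtree.verts_subset_insert_side (hT : T.IsTree) {H : T.Subgraph} (hH : IsSubtree H)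
    {v w : V} (hv : v ∈ H.verts) (hw : ∀ x, H.Adj v x → x = w) :
    H.verts ⊆ insert v (side T w v) := by
  intro y hy
  by_cases hyv : v = y
  · exact Or.inl hyv.symm
  · obtain ⟨z, hz, hd⟩ := exists_adj_dist_add_one hT.1 hyv
    have hz' : z ∈ H.verts := by
      apply hH.mem_of_dist_add hT hv hy
      rw [SimpleGraph.dist_eq_one_iff_adj.2 hz]
      omega
    rw [← hw z (hH.adj hT hv hz' hz)]
    right
    rw [mem_side]
    omega

lemma IsSubtree.ncard_edgeSet_le [Finite V] (hT : T.IsTree) {H : T.Subgraph} (hH : IsSubtree H)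
    {v w : V} (hv : v ∈ H.verts) (hw : ∀ x, H.Adj v x → x = w) :
    H.edgeSet.ncard ≤ (side T w v).ncard := by
  have h1 := hH.ncard_edgeSet_add_one
  have h2 := Set.ncard_le_ncard (hH.verts_subset_insert_side hT hv hw)
  have h3 := Set.ncard_insert_le v (side T w v)
  omega

/-- The branches at `v` are the components of `T - v`, each extended by its edge to `v`. -/
lemma isBranch_induce_insert_side (hT : T.IsTree) {v w : V} (h : T.Adj v w) :
    IsBranch v ((⊤ : T.Subgraph).induce (insert v (side T w v))) := by
  have hsub : IsSubtree ((⊤ : T.Subgraph).induce (insert v (side T w v))) := by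
    apply isSubtree_induce hT.isAcyclic (Set.mem_insert v _) (T.dist v)
    rintro z (rfl | hz) hzv
    · exact absurd rfl hzv
    · rw [mem_side] at hz
      have hz' := dist_adj_cases hT h z
      by_cases hzw : z = w
      · subst hzw
        exact ⟨v, Set.mem_insert v _, h, by simpa using hT.1.pos_dist_of_ne h.ne⟩
      · obtain ⟨x, hx, hd⟩ := exists_adj_dist_add_one hT.1 hzw
        rw [T.dist_comm (u := x), T.dist_comm (u := z)] at hd
        have h1 := hT.1.dist_triangle (u := v) (v := w) (w := x)
        have h2 := hT.1.dist_triangle (u := v) (v := x) (w := z)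
        rw [SimpleGraph.dist_eq_one_iff_adj.2 h] at h1
        rw [SimpleGraph.dist_eq_one_iff_adj.2 hx.symm] at h2
        exact ⟨x, Or.inr (mem_side.2 (by omega)), hx.symm, by omega⟩
  have hadj : ∀ x, ((⊤ : T.Subgraph).induce (insert v (side T w v))).Adj v x → x = w := by
    rintro x ⟨-, rfl | hx, hvx⟩
    · exact absurd hvx (SimpleGraph.irrefl _)
    · rw [mem_side, SimpleGraph.dist_eq_one_iff_adj.2 hvx] at hx
      exact (hT.1.dist_eq_zero_iff.1 (by omega)).symm
  have hw : w ∈ side T w v := mem_side_self h.symm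
  refine ⟨⟨hsub, Set.mem_insert v _, w, ⟨Set.mem_insert v _, Or.inr hw, h⟩, hadj⟩, ?_⟩
  rintro K ⟨hK, hv, x, hx, hux⟩ hle
  have hxw : w = x := hux w (hle.2 ⟨Set.mem_insert v _, Or.inr hw, h⟩)
  subst hxw
  exact hsub.le_of_verts hT (hK.verts_subset_insert_side hT hv hux)

lemma mem_upperBounds_branch [Finite V] (hT : T.IsTree) {v : V} {k : ℕ}
    (h : ∀ w, T.Adj v w → (side T w v).ncard ≤ k) :
    k ∈ upperBounds {k : ℕ | ∃ H : T.Subgraph, IsBranch v H ∧ H.edgeSet.ncard = k} := by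
  rintro _ ⟨H, ⟨⟨hH, hv, w, hw, hu⟩, -⟩, rfl⟩
  exact (hH.ncard_edgeSet_le hT hv hu).trans (h w hw.adj_sub)

lemma weight_le [Finite V] (hT : T.IsTree) {v : V} {k : ℕ}
    (h : ∀ w, T.Adj v w → (side T w v).ncard ≤ k) : weight T v ≤ k :=
  csSup_le' (mem_upperBounds_branch hT h)

lemma ncard_side_le_weight [Finite V] (hT : T.IsTree) {v w : V} (h : T.Adj v w) :
    (side T w v).ncard ≤ weight T v := by
  apply le_csSup ⟨_, mem_upperBounds_branch hT fun w _ ↦ Set.ncard_le_ncard (Set.subset_univ _)⟩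
  refine ⟨_, isBranch_induce_insert_side hT h, ?_⟩
  have h1 := (isBranch_induce_insert_side hT h).1.1.ncard_edgeSet_add_one
  rw [SimpleGraph.Subgraph.induce_verts, Set.ncard_insert_of_notMem] at h1
  · omega
  · rw [mem_side, SimpleGraph.dist_self]
    omega

/-- The branch at `x` through `u` has `side T u x` as its other vertices; every other branch at
`x` lies in `side T x u`. -/
lemma weight_le_max [Finite V] (hT : T.IsTree) {u x : V} (hux : T.Adj u x) :
    weight T x ≤ max (side T u x).ncard ((side T x u).ncard - 1) := by
  apply weight_le hT
  intro w hw
  by_cases hwu : w = u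
  · exact hwu ▸ le_max_left _ _
  · refine le_max_of_le_right ?_
    rw [← Set.ncard_sdiff_singleton_of_mem (mem_side_self hux.symm)]
    refine Set.ncard_le_ncard (fun y hy ↦ ?_) (Set.toFinite _)
    have hy' := mem_side.1 hy
    have hxu := SimpleGraph.dist_eq_one_iff_adj.2 hux.symm
    have hu : u ∈ side T x w := by
      rw [mem_side]
      have := dist_adj_cases hT hw u
      have := hT.1.pos_dist_of_ne hwu
      omega
    have h := dist_across hT hw hu hy
    have h1 := dist_adj_cases hT hw y
    rw [T.dist_comm (u := u) (v := x)] at h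
    refine ⟨mem_side.2 (by omega), fun hyx ↦ ?_⟩
    rw [Set.mem_singleton_iff.1 hyx, SimpleGraph.dist_self] at hy'
    omega

lemma ncard_side_le_of_mem_centroid [Finite V] (hT : T.IsTree) {u x : V} (hux : T.Adj u x)
    (hu : u ∈ centroid T) : (side T x u).ncard ≤ (side T u x).ncard := by
  have h1 := ncard_side_le_weight hT hux
  have h2 := weight_le_max hT hux
  have h3 := hu x
  have h4 := (Set.ncard_pos (Set.toFinite _)).2 ⟨x, mem_side_self hux.symm⟩
  omega

lemma ncard_side_lt_of_notMem_centroid [Finite V] (hT : T.IsTree) {u x : V} (hux : T.Adj u x)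
    (hu : u ∈ centroid T) (hx : x ∉ centroid T) :
    (side T x u).ncard < (side T u x).ncard := by
  by_contra! hle
  apply hx
  intro y
  have h1 := ncard_side_le_weight hT hux
  have h2 := weight_le_max hT hux
  have h3 := hu y
  omega

/-! ### The centre -/

lemma exists_dist_le_of_mem_center [Finite V] (hT : T.Connected) {u : V} (hu : u ∈ T.center)
    (x : V) : ∃ y, ∀ z, T.dist u z ≤ T.dist x y := by
  have := hT.nonempty
  obtain ⟨y, hy⟩ := T.exists_edist_eq_eccent_of_finite x
  refine ⟨y, fun z ↦ ?_⟩
  have h : T.edist u z ≤ T.edist x y := by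
    rw [hy]
    exact SimpleGraph.edist_le_eccent.trans (hu.trans_le SimpleGraph.radius_le_eccent)
  rw [← (hT u z).coe_dist_eq_edist, ← (hT x y).coe_dist_eq_edist] at h
  exact_mod_cast h

lemma exists_dist_lt_of_notMem_center [Finite V] (hT : T.Connected) {u x : V}
    (hu : u ∈ T.center) (hx : x ∉ T.center) : ∃ y, ∀ z, T.dist u z < T.dist x y := by
  have := hT.nonempty
  obtain ⟨y, hy⟩ := T.exists_edist_eq_eccent_of_finite x
  refine ⟨y, fun z ↦ ?_⟩
  have h : T.edist u z < T.edist x y := by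
    rw [hy]
    refine lt_of_le_of_lt (SimpleGraph.edist_le_eccent.trans_eq hu) ?_
    exact lt_of_le_of_ne SimpleGraph.radius_le_eccent (Ne.symm hx)
  rw [← (hT u z).coe_dist_eq_edist, ← (hT x y).coe_dist_eq_edist] at h
  exact_mod_cast h

/-! ### Upper bounds for the distances to the subtree core -/

lemma setDist_le {U W : Set V} {u w : V} (hu : u ∈ U) (hw : w ∈ W) :
    setDist T U W ≤ T.dist u w :=
  Nat.sInf_le ⟨u, hu, w, hw, rfl⟩

lemma le_setDist {U W : Set V} {k : ℕ} (hU : U.Nonempty) (hW : W.Nonempty)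
    (h : ∀ u ∈ U, ∀ w ∈ W, k ≤ T.dist u w) : k ≤ setDist T U W := by
  obtain ⟨u, hu⟩ := hU
  obtain ⟨w, hw⟩ := hW
  refine le_csInf (s := {d | ∃ u ∈ U, ∃ w ∈ W, T.dist u w = d}) ⟨_, u, hu, w, hw, rfl⟩ ?_
  rintro _ ⟨u, hu, w, hw, rfl⟩
  exact h u hu w hw

/-- If `U` and `W` are disjoint, take the path between two closest vertices `u ∈ U` and `w ∈ W`:
the neighbours `x` of `u` and `x'` of `w` on it lie outside `U` and `W` respectively, and the
component at the far end, together with the interior of the path, lies beyond the edge `ux`. -/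
lemma exists_geodesic_of_setDist_pos [Finite V] (hT : T.IsTree) {U W : Set V}
    (h : 0 < setDist T U W) : ∃ u ∈ U, ∃ w ∈ W, ∃ x x', T.Adj u x ∧ T.Adj x' w ∧
      x ∉ U ∧ x' ∉ W ∧ (side T w x').ncard + setDist T U W ≤ (side T x u).ncard + 1 ∧
      ∀ y ∈ side T w x', T.dist u y = setDist T U W + T.dist w y := by
  have hne : {d : ℕ | ∃ u ∈ U, ∃ w ∈ W, T.dist u w = d}.Nonempty := by
    by_contra hne
    rw [Set.not_nonempty_iff_eq_empty] at hne
    rw [setDist, hne, Nat.sInf_empty] at h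
    omega
  obtain ⟨u, hu, w, hw, hd⟩ := Nat.sInf_mem hne
  change T.dist u w = setDist T U W at hd
  obtain ⟨z, h0, h1, hz⟩ := exists_geodesic hT.1 u w
  rw [hd] at h1 hz
  generalize hD : setDist T U W = d at *
  have hux : T.dist u (z 1) = 1 := by simpa [h0] using hz 0 1 (by omega) h
  have hxw : T.dist (z 1) w = d - 1 := by simpa [h1] using hz 1 d h le_rfl
  have hux' : T.dist u (z (d - 1)) = d - 1 := by simpa [h0] using hz 0 (d - 1) (by omega) (by omega)
  have hxw' : T.dist (z (d - 1)) w = 1 := by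
    have := hz (d - 1) d (by omega) le_rfl
    rw [h1] at this
    omega
  have hadj := SimpleGraph.dist_eq_one_iff_adj.1 hux
  have hadj' := SimpleGraph.dist_eq_one_iff_adj.1 hxw'
  have hfar : ∀ y ∈ side T w (z (d - 1)), T.dist u y = d + T.dist w y := by
    intro y hy
    have := dist_across hT hadj' (a := u) (by
      rw [mem_side, T.dist_comm, T.dist_comm (u := w)]; omega) hy
    omega
  refine ⟨u, hu, w, hw, z 1, z (d - 1), hadj, hadj', fun hx ↦ ?_, fun hx ↦ ?_, ?_, hfar⟩
  · have := setDist_le (T := T) hx hw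
    omega
  · have := setDist_le (T := T) hu hx
    omega
  · have hinj : Set.InjOn z (Set.Icc 1 (d - 1)) := by
      intro i hi j hj hij
      obtain ⟨hi1, hi2⟩ := hi
      obtain ⟨hj1, hj2⟩ := hj
      have a := hz 0 i (by omega) (by omega)
      have b := hz 0 j (by omega) (by omega)
      rw [hij] at a
      omega
    have hcard : (z '' Set.Icc 1 (d - 1)).ncard = d - 1 := by
      rw [hinj.ncard_image, Set.ncard_eq_toFinset_card']
      simp
    have hdisj : Disjoint (side T w (z (d - 1))) (z '' Set.Icc 1 (d - 1)) := by
      rw [Set.disjoint_left]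
      rintro _ hy ⟨j, ⟨hj1, hj2⟩, rfl⟩
      have a := hz j (d - 1) hj2 (by omega)
      have b := hz j d (by omega) le_rfl
      rw [h1] at b
      rw [mem_side, T.dist_comm (u := w), T.dist_comm (u := z (d - 1))] at hy
      omega
    have hsub : side T w (z (d - 1)) ∪ z '' Set.Icc 1 (d - 1) ⊆ side T (z 1) u := by
      rintro y (hy | ⟨j, ⟨hj1, hj2⟩, rfl⟩)
      · have a := hfar y hy
        have b := hT.1.dist_triangle (u := z 1) (v := w) (w := y)
        rw [mem_side]
        omega
      · have a := hz 0 j (by omega) (by omega)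
        have b := hz 1 j (by omega) (by omega)
        rw [h0] at a
        rw [mem_side]
        omega
    have hle := Set.ncard_le_ncard hsub
    rw [Set.ncard_union_eq hdisj, hcard] at hle
    omega

lemma dist_lt_ncard_side [Finite V] (hT : T.IsTree) {u x y : V} (hy : y ∈ side T u x) :
    T.dist u y < (side T u x).ncard := by
  obtain ⟨z, h0, h1, hz⟩ := exists_geodesic hT.1 u y
  have hinj : Set.InjOn z (Set.Iic (T.dist u y)) := by
    intro i hi j hj hij
    have a := hz 0 i (by omega) hi
    have b := hz 0 j (by omega) hj
    rw [hij] at a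
    omega
  have hcard : (z '' Set.Iic (T.dist u y)).ncard = T.dist u y + 1 := by
    rw [hinj.ncard_image, Set.ncard_eq_toFinset_card']
    simp
  have hsub : z '' Set.Iic (T.dist u y) ⊆ side T u x := by
    rintro _ ⟨j, hj, rfl⟩
    have a := hz 0 j (by omega) hj
    have b := hz j _ hj le_rfl
    rw [h0] at a
    rw [h1] at b
    have c := hT.1.dist_triangle (u := x) (v := z j) (w := y)
    rw [mem_side] at hy ⊢
    have d : j ≤ T.dist u y := hj
    omega
  have := Set.ncard_le_ncard hsub
  omega

lemma subtreeCount_lt_of_notMem_subtreeCore {s x : V} (hs : s ∈ subtreeCore T)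
    (hx : x ∉ subtreeCore T) :
    subtreeCount T x < subtreeCount T s := by
  by_contra! hle
  exact hx fun u ↦ (hs u).trans hle

lemma setDist_centroid_subtreeCore_le [Fintype V] (hT : T.IsTree) {g : ℕ}
    (hg : ∀ k, Fintype.card V < 2 ^ (k - 1) + k → g < k) (hgV : g ≤ (Fintype.card V - 1) / 2) :
    setDist T (centroid T) (subtreeCore T) + g ≤ (Fintype.card V - 1) / 2 := by
  rcases Nat.eq_zero_or_pos (setDist T (centroid T) (subtreeCore T)) with h0 | hpos
  · omega
  obtain ⟨u, hu, s, hs, x, x', hux, hxs, hx, hx', hcard, -⟩ :=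
    exists_geodesic_of_setDist_pos hT hpos
  have h1 := hg _ (card_lt_of_subtreeCount_lt hT hxs (subtreeCount_lt_of_notMem_subtreeCore hs hx'))
  have h2 := ncard_side_lt_of_notMem_centroid hT hux hu hx
  have h3 := ncard_side_add hT hux
  omega

lemma setDist_center_subtreeCore_le [Fintype V] (hT : T.IsTree) {g : ℕ} (hg0 : 0 < g)
    (hg : ∀ k, Fintype.card V < 2 ^ (k - 1) + k → g < k) (hgV : g + 2 ≤ Fintype.card V) :
    2 * setDist T T.center (subtreeCore T) + g + 2 ≤ Fintype.card V := by
  rcases Nat.eq_zero_or_pos (setDist T T.center (subtreeCore T)) with h0 | hpos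
  · omega
  obtain ⟨u, hu, s, hs, x, x', hux, hxs, hx, hx', hcard, hfar⟩ :=
    exists_geodesic_of_setDist_pos hT hpos
  have h1 := hg _ (card_lt_of_subtreeCount_lt hT hxs (subtreeCount_lt_of_notMem_subtreeCore hs hx'))
  -- A second vertex `y` of the component of `s` lies beyond `s` when seen from `u`.
  obtain ⟨y, hy, hys⟩ := Set.exists_ne_of_one_lt_ncard (s := side T s x') (by omega) s
  have h2 := hfar y hy
  have h3 := hT.1.pos_dist_of_ne hys.symm
  -- As `x` is not central, some vertex `t` on the side of `u` is further away still.
  obtain ⟨t, ht⟩ := exists_dist_lt_of_notMem_center hT.1 hu hx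
  have h4 := dist_lt_ncard_side hT (mem_side.2 (ht t))
  have h5 := dist_adj_cases hT hux t
  have h6 := ht y
  have h7 := ht t
  have h8 := ncard_side_add hT hux
  omega

/-! ### Path-star trees -/

/-- Every vertex `j ≠ 0` of a path-star has exactly one smaller neighbour, `min (j - 1) (n-g-1)`. -/
lemma pathStar_adj_iff {n g : ℕ} (hg : g < n) {i j : Fin n} : (pathStar n g).Adj i j ↔
    (i.val < j.val ∧ i.val = min (j.val - 1) (n - g - 1)) ∨
      (j.val < i.val ∧ j.val = min (i.val - 1) (n - g - 1)) := by
  rw [pathStar, SimpleGraph.fromRel_adj, ne_eq, Fin.ext_iff]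
  omega

lemma exists_pathStar_adj_lt {n g : ℕ} (hg : g < n) {j : Fin n} (hj : 0 < j.val) :
    ∃ i : Fin n, i.val = min (j.val - 1) (n - g - 1) ∧ (pathStar n g).Adj i j := by
  have := j.2
  refine ⟨⟨min (j.val - 1) (n - g - 1), by omega⟩, rfl, (pathStar_adj_iff hg).2 (Or.inl ?_)⟩
  dsimp only
  omega

lemma pathStar_connected {n g : ℕ} (hg : g < n) : (pathStar n g).Connected := by
  have hreach : ∀ m : ℕ, ∀ j : Fin n, j.val = m →
      (pathStar n g).Reachable ⟨0, by omega⟩ j := by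
    intro m
    induction m using Nat.strong_induction_on with
    | _ m ih =>
      intro j hm
      rcases Nat.eq_zero_or_pos j.val with h0 | hpos
      · rw [show j = ⟨0, by omega⟩ from Fin.ext h0]
      · obtain ⟨i, hi, hadj⟩ := exists_pathStar_adj_lt hg hpos
        exact (ih i.val (by omega) i rfl).trans hadj.reachable
  have : Nonempty (Fin n) := ⟨⟨0, by omega⟩⟩
  exact ⟨fun a b ↦ (hreach _ a rfl).symm.trans (hreach _ b rfl)⟩

lemma pathStar_isTree {n g : ℕ} (hg : g < n) : (pathStar n g).IsTree := by
  have hc := pathStar_connected hg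
  refine SimpleGraph.isTree_iff_connected_and_card.2 ⟨hc, le_antisymm ?_
    hc.card_vert_le_card_edgeSet_add_one⟩
  let z : Fin n := ⟨0, by omega⟩
  -- Each edge is determined by its larger end.
  let e : Fin n → Sym2 (Fin n) :=
    fun j ↦ s(⟨min (j.val - 1) (n - g - 1), by have := j.2; omega⟩, j)
  have hsub : (pathStar n g).edgeSet ⊆ e '' {z}ᶜ := by
    intro p
    induction p using Sym2.ind with
    | _ i j =>
      rw [SimpleGraph.mem_edgeSet, pathStar_adj_iff hg]
      rintro (⟨hlt, h⟩ | ⟨hlt, h⟩)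
      · refine ⟨j, fun hj ↦ ?_, ?_⟩
        · have : j.val = 0 := congrArg Fin.val hj
          omega
        · exact congrArg (fun x ↦ s(x, j)) (Fin.ext h.symm)
      · refine ⟨i, fun hi ↦ ?_, ?_⟩
        · have : i.val = 0 := congrArg Fin.val hi
          omega
        · rw [Sym2.eq_swap]
          exact congrArg (fun x ↦ s(x, i)) (Fin.ext h.symm)
  have h1 := Set.ncard_le_ncard hsub
  have h2 := Set.ncard_image_le (f := e) (s := {z}ᶜ)
  rw [Set.ncard_compl, Set.ncard_singleton, Nat.card_fin] at h2
  rw [Nat.card_coe_set_eq, Nat.card_fin]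
  omega

/-- Distances from a vertex `i` on the path of a path-star to a later vertex: the vertex `j` has
depth `min j (n - g)`. -/
lemma dist_pathStar {n g : ℕ} (hg : g < n) {i j : Fin n} (hi : i.val < n - g)
    (hij : i.val ≤ j.val) : (pathStar n g).dist i j = min j.val (n - g) - i.val := by
  have hc := pathStar_connected hg
  apply le_antisymm
  · have hle : ∀ m : ℕ, ∀ j : Fin n, j.val = m → i.val ≤ j.val →
        (pathStar n g).dist i j ≤ min j.val (n - g) - i.val := by
      intro m
      induction m using Nat.strong_induction_on with
      | _ m ih =>
        intro j hm hij
        rcases hij.eq_or_lt with h | hlt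
        · rw [Fin.ext h, SimpleGraph.dist_self]
          omega
        · obtain ⟨k, hk, hadj⟩ := exists_pathStar_adj_lt hg (j := j) (by omega)
          have h1 := ih k.val (by omega) k rfl (by omega)
          have h2 := hc.dist_triangle (u := i) (v := k) (w := j)
          rw [SimpleGraph.dist_eq_one_iff_adj.2 hadj] at h2
          omega
    exact hle _ j rfl hij
  · have hlip : ∀ {i j : Fin n} (p : (pathStar n g).Walk i j),
        min j.val (n - g) ≤ min i.val (n - g) + p.length := by
      intro i j p
      induction p with
      | nil => exact Nat.le_add_right _ _
      | cons h p ih =>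
        rw [pathStar_adj_iff hg] at h
        rw [SimpleGraph.Walk.length_cons]
        omega
    obtain ⟨p, hp⟩ := hc.exists_walk_length_eq_dist i j
    have := hlip p
    omega

lemma side_pathStar_of_leaf {n g : ℕ} (hg : g < n) {s w : Fin n} (hs : s.val = n - g - 1)
    (hw : n - g ≤ w.val) : side (pathStar n g) w s ⊆ {w} := by
  intro y hy
  by_contra hyw
  obtain ⟨x, hx, hd⟩ := exists_adj_dist_add_one (pathStar_connected hg) (Ne.symm hyw)
  have hxs : x = s := by
    rw [pathStar_adj_iff hg] at hx
    exact Fin.ext (by omega)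
  rw [hxs] at hd
  rw [mem_side] at hy
  omega

/-- Subtrees through `a` avoiding the next vertex `b` of the path are the intervals ending in
`a`. -/
lemma avoidCount_pathStar_le {n g : ℕ} (hg : g < n) {a b : Fin n} (hab : b.val = a.val + 1)
    (hb : b.val < n - g) : avoidCount (pathStar n g) a b ≤ a.val + 1 := by
  have hT := pathStar_isTree hg
  have hadj : (pathStar n g).Adj a b := (pathStar_adj_iff hg).2 (Or.inl (by omega))
  have hsub : {H : (pathStar n g).Subgraph | IsSubtree H ∧ a ∈ H.verts ∧ b ∉ H.verts} ⊆
      (fun m ↦ (⊤ : (pathStar n g).Subgraph).induce (Set.Icc m a)) '' Set.Iic a := by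
    rintro H ⟨hH, ha, hb'⟩
    have hle : ∀ y ∈ H.verts, y ≤ a := by
      intro y hy
      have h1 := mem_side.1 (hH.verts_subset_side hT hadj ha hb' hy)
      by_contra! hlt
      rw [dist_pathStar hg (by omega) hlt.le, dist_pathStar hg hb (by omega)] at h1
      omega
    obtain ⟨m, hm, hmin⟩ := Set.exists_min_image H.verts id (Set.toFinite _) ⟨a, ha⟩
    have hIcc : H.verts = Set.Icc m a := by
      refine Set.Subset.antisymm (fun y hy ↦ ⟨hmin y hy, hle y hy⟩) ?_
      rintro y ⟨hmy, hya⟩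
      apply hH.mem_of_dist_add hT hm ha
      rw [Fin.le_def] at hmy hya
      rw [dist_pathStar hg (by omega) hmy, dist_pathStar hg (by omega) hya,
        dist_pathStar hg (by omega) (hmy.trans hya)]
      omega
    refine ⟨m, hle m hm, ?_⟩
    dsimp only
    rw [← hIcc]
    exact SimpleGraph.Subgraph.IsInduced.induce_top_verts fun _ hx _ hy ↦ hH.adj hT hx hy
  calc avoidCount (pathStar n g) a b ≤ _ := Set.ncard_le_ncard hsub
    _ ≤ (Set.Iic a).ncard := Set.ncard_image_le
    _ = a.val + 1 := by rw [Set.ncard_eq_toFinset_card']; simp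

/-- The path from `b` to the centre of the star, together with any set of leaves, is a subtree
avoiding the vertex `a` before `b`. -/
lemma two_pow_le_avoidCount_pathStar {n g : ℕ} (hg0 : 0 < g) (hg : g < n) {a b : Fin n}
    (hab : b.val = a.val + 1) (hb : b.val < n - g) : 2 ^ g ≤ avoidCount (pathStar n g) b a := by
  let l : Fin n := ⟨n - g, by omega⟩
  have hl : (Set.Ici l).ncard = g := by
    rw [Set.ncard_eq_toFinset_card']
    simp only [Set.toFinset_Ici, Fin.card_Ici, l]
    omega
  have hpow : (𝒫 (Set.Ici l)).ncard = 2 ^ g := by rw [Set.ncard_powerset, hl]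
  rw [← hpow]
  apply Set.ncard_le_ncard_of_injOn
    (fun A ↦ (⊤ : (pathStar n g).Subgraph).induce (Set.Ico b l ∪ A))
  · intro A hA
    have hbl : b < l := hb
    have hbA : b ∈ Set.Ico b l ∪ A := Or.inl ⟨le_rfl, hbl⟩
    have hle : ∀ z ∈ Set.Ico b l ∪ A, b ≤ z := by
      rintro z (hz | hz)
      · exact hz.1
      · exact hbl.le.trans (hA hz)
    refine ⟨isSubtree_induce (pathStar_isTree hg).isAcyclic hbA Fin.val ?_, hbA, fun ha ↦ ?_⟩
    · intro z hz hzb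
      have h1 : b.val ≤ z.val := hle z hz
      have h2 : b.val ≠ z.val := fun h ↦ hzb (Fin.ext h.symm)
      obtain ⟨w, hw, hadj⟩ := exists_pathStar_adj_lt hg (j := z) (by omega)
      have hlv : l.val = n - g := rfl
      refine ⟨w, Or.inl ⟨?_, ?_⟩, hadj, ?_⟩
      · rw [Fin.le_def]
        omega
      · rw [Fin.lt_def]
        omega
      · omega
    · have : b.val ≤ a.val := hle a ha
      omega
  · have hrec : ∀ A ∈ (Set.Ici l).powerset, (Set.Ico b l ∪ A) ∩ Set.Ici l = A := by
      intro A hA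
      ext z
      constructor
      · rintro ⟨hz | hz, hz'⟩
        · exact absurd hz.2 (not_lt.2 hz')
        · exact hz
      · exact fun hz ↦ ⟨Or.inr hz, hA hz⟩
    intro A hA B hB heq
    have h : Set.Ico b l ∪ A = Set.Ico b l ∪ B := congrArg SimpleGraph.Subgraph.verts heq
    rw [← hrec A hA, ← hrec B hB, h]

/-- When the star outweighs the path, the subtree core is the centre of the star. -/
lemma eq_of_mem_subtreeCore_pathStar {n g : ℕ} (hg0 : 0 < g) (hgn : g + 3 ≤ n)
    (hlt : n - 1 < 2 ^ g + g) {w : Fin n} (hw : w ∈ subtreeCore (pathStar n g)) :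
    w.val = n - g - 1 := by
  have hg : g < n := by omega
  have hT := pathStar_isTree hg
  rcases lt_trichotomy w.val (n - g - 1) with h | h | h
  · let b : Fin n := ⟨w.val + 1, by omega⟩
    have hb : b.val = w.val + 1 := rfl
    have h1 := avoidCount_pathStar_le hg hb (by omega)
    have h2 := two_pow_le_avoidCount_pathStar hg0 hg hb (by omega)
    have h3 := (subtreeCount_lt_iff (T := pathStar n g) b w).2 (by omega)
    exact absurd (hw b) (not_le.2 h3)
  · exact h
  · let s : Fin n := ⟨n - g - 1, by omega⟩
    have hadj : (pathStar n g).Adj w s := by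
      rw [pathStar_adj_iff hg]
      have hs : s.val = n - g - 1 := rfl
      omega
    have h1 := avoidCount_le_two_pow hT hadj
    have h2 := Set.ncard_le_ncard (side_pathStar_of_leaf hg (s := s) rfl (w := w) (by omega))
    rw [Set.ncard_singleton] at h2
    rw [Nat.sub_eq_zero_of_le h2, pow_zero] at h1
    have h3 := ncard_side_le_avoidCount hT hadj.symm
    have h4 := ncard_side_add hT hadj
    rw [Fintype.card_fin] at h4
    have h5 := (subtreeCount_lt_iff (T := pathStar n g) s w).2 (by omega)
    exact absurd (hw s) (not_le.2 h5)

lemma two_mul_le_of_mem_center_pathStar {n g : ℕ} (hgn : g + 3 ≤ n) {u : Fin n}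
    (hu : u ∈ (pathStar n g).center) : 2 * u.val ≤ n - g + 1 := by
  have hg : g < n := by omega
  have hc := pathStar_connected hg
  have key : ∀ x y : Fin n, x.val < n - g →
      (pathStar n g).dist x y ≤ max x.val (n - g - x.val) := by
    intro x y hx
    rcases le_total x.val y.val with h | h
    · rw [dist_pathStar hg hx h]
      omega
    · rw [SimpleGraph.dist_comm, dist_pathStar hg (by omega) h]
      omega
  by_contra! hlt
  obtain ⟨x, hx, -⟩ := exists_pathStar_adj_lt hg (j := u) (by omega)
  obtain ⟨y, hy⟩ := exists_dist_le_of_mem_center hc hu x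
  have h1 := hy ⟨0, by omega⟩
  rw [SimpleGraph.dist_comm, dist_pathStar hg (by dsimp only; omega) (by simp)] at h1
  have h2 := key x y (by omega)
  dsimp only at h1
  omega

lemma two_mul_le_of_mem_centroid_pathStar {n g : ℕ} (hgn : g + 3 ≤ n) {u : Fin n}
    (hu : u ∈ centroid (pathStar n g)) : 2 * u.val ≤ n ∧ u.val < n - g := by
  have hg : g < n := by omega
  have hT := pathStar_isTree hg
  rcases Nat.eq_zero_or_pos u.val with h0 | hpos
  · omega
  obtain ⟨x, hx, hadj⟩ := exists_pathStar_adj_lt hg hpos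
  have h1 := ncard_side_le_of_mem_centroid hT hadj.symm hu
  have h2 := ncard_side_add hT hadj
  rw [Fintype.card_fin] at h2
  rcases lt_or_ge u.val (n - g) with h | h
  · refine ⟨?_, h⟩
    have hsub : Set.Iio u ⊆ side (pathStar n g) x u := by
      intro y hy
      have hyu : y.val < u.val := hy
      rw [mem_side, SimpleGraph.dist_comm, SimpleGraph.dist_comm (u := u),
        dist_pathStar hg (by omega) (by omega), dist_pathStar hg (by omega) hyu.le]
      omega
    have h3 := Set.ncard_le_ncard hsub
    rw [Set.ncard_eq_toFinset_card'] at h3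
    simp only [Set.toFinset_Iio, Fin.card_Iio] at h3
    omega
  · have h3 := Set.ncard_le_ncard (side_pathStar_of_leaf hg (s := x) (by omega) h)
    rw [Set.ncard_singleton] at h3
    omega

lemma subtreeCore_nonempty {V : Type*} [Finite V] [Nonempty V] (T : SimpleGraph V) :
    (subtreeCore T).Nonempty :=
  Finite.exists_max (subtreeCount T)

lemma centroid_nonempty {V : Type*} [Finite V] [Nonempty V] (T : SimpleGraph V) :
    (centroid T).Nonempty :=
  Finite.exists_min (weight T)

lemma le_setDist_center_pathStar {n g : ℕ} (hg0 : 0 < g) (hgn : g + 3 ≤ n)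
    (hlt : n - 1 < 2 ^ g + g) :
    (n - g) / 2 - 1 ≤ setDist (pathStar n g) (pathStar n g).center
      (subtreeCore (pathStar n g)) := by
  have : Nonempty (Fin n) := ⟨⟨0, by omega⟩⟩
  refine le_setDist SimpleGraph.center_nonempty (subtreeCore_nonempty _) fun u hu w hw ↦ ?_
  have h1 := two_mul_le_of_mem_center_pathStar hgn hu
  have h2 := eq_of_mem_subtreeCore_pathStar hg0 hgn hlt hw
  rw [dist_pathStar (by omega) (by omega) (by omega)]
  omega

lemma le_setDist_centroid_pathStar {n g : ℕ} (hg0 : 0 < g) (hgn : g + 3 ≤ n)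
    (hlt : n - 1 < 2 ^ g + g) :
    (n - 1) / 2 - g ≤ setDist (pathStar n g) (centroid (pathStar n g))
      (subtreeCore (pathStar n g)) := by
  have : Nonempty (Fin n) := ⟨⟨0, by omega⟩⟩
  refine le_setDist (centroid_nonempty _) (subtreeCore_nonempty _) fun u hu w hw ↦ ?_
  have h1 := two_mul_le_of_mem_centroid_pathStar hgn hu
  have h2 := eq_of_mem_subtreeCore_pathStar hg0 hgn hlt hw
  rw [dist_pathStar (by omega) (by omega) (by omega)]
  omega

end PathStar

/-- Division by `2` below is integer division, so it is the floor of the quotient. -/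
theorem theorem1p5 (n g₀ : ℕ) (hn : 5 ≤ n)
    (hg₀ : IsLeast {g : ℕ | 0 < g ∧ n - 1 < 2 ^ g + g} g₀) :
    (∀ (V : Type*) [Fintype V] (T : SimpleGraph V), T.IsTree → Fintype.card V = n →
      (PathStar.setDist T T.center (PathStar.subtreeCore T) : ℤ) ≤ ((n : ℤ) - g₀) / 2 - 1 ∧
      (PathStar.setDist T (PathStar.centroid T) (PathStar.subtreeCore T) : ℤ)
        ≤ ((n : ℤ) - 1) / 2 - g₀) ∧
    (2 ≤ g₀ ∧ g₀ ≤ n - 3 ∧ (PathStar.pathStar n g₀).IsTree ∧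
      (PathStar.setDist (PathStar.pathStar n g₀) (PathStar.pathStar n g₀).center
        (PathStar.subtreeCore (PathStar.pathStar n g₀)) : ℤ) = ((n : ℤ) - g₀) / 2 - 1 ∧
      (PathStar.setDist (PathStar.pathStar n g₀) (PathStar.centroid (PathStar.pathStar n g₀))
        (PathStar.subtreeCore (PathStar.pathStar n g₀)) : ℤ) = ((n : ℤ) - 1) / 2 - g₀) := by
  obtain ⟨⟨hpos, hlt⟩, hmin⟩ := hg₀
  have hmin' : ∀ g, 0 < g → n - 1 < 2 ^ g + g → g₀ ≤ g := fun g h1 h2 ↦ hmin ⟨h1, h2⟩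
  have hk : ∀ k, n < 2 ^ (k - 1) + k → g₀ < k := by
    intro k h
    rcases le_or_gt k 1 with hk | hk
    · rw [Nat.sub_eq_zero_of_le hk, pow_zero] at h
      omega
    · have := hmin' (k - 1) (by omega) (by omega)
      omega
  have h2 : 2 ≤ g₀ := by
    by_contra! h
    obtain rfl : g₀ = 1 := by omega
    omega
  -- The exponents `n - 3` and `(n - 1) / 2` are already admissible, by `2 ^ m ≥ m + 2`.
  have hpow : ∀ m, 2 ≤ m → m + 2 ≤ 2 ^ m := by
    intro m hm
    induction m, hm using Nat.le_induction with
    | base => norm_num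
    | succ m hm ih => rw [pow_succ]; omega
  have hn3 : g₀ ≤ n - 3 := by
    have := hpow (n - 3) (by omega)
    exact hmin' _ (by omega) (by omega)
  have hhalf : g₀ ≤ (n - 1) / 2 := by
    have := hpow ((n - 1) / 2) (by omega)
    exact hmin' _ (by omega) (by omega)
  have hP := PathStar.pathStar_isTree (n := n) (g := g₀) (by omega)
  have hcard := Fintype.card_fin n
  refine ⟨fun V _ T hT hV ↦ ?_, h2, hn3, hP, ?_, ?_⟩
  · subst hV
    have h3 := PathStar.setDist_center_subtreeCore_le hT hpos hk (by omega)
    have h4 := PathStar.setDist_centroid_subtreeCore_le hT hk hhalf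
    omega
  · have h3 := PathStar.setDist_center_subtreeCore_le hP hpos (by rwa [hcard]) (by omega)
    have h4 := PathStar.le_setDist_center_pathStar hpos (by omega) hlt
    omega
  · have h3 := PathStar.setDist_centroid_subtreeCore_le hP (by rwa [hcard]) (by omega)
    have h4 := PathStar.le_setDist_centroid_pathStar hpos (by omega) hlt
    omega
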